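/- Let $k$ be a field and let $\mathcal C$ be a semisimple $k$-linear pivotal monoidal category: $\mathcal C$ is an abelian $k$-linear monoidal category with bilinear tensor product, every object is a finite direct sum of simple objects (where a simple object is also required to have endomorphism ring $k$), the unit object $I$ is simple, every object $X$ has a dual $X^\vee$ with $\mathrm{ev}\colon X^\vee\otimes X\to I$ and $\mathrm{db}\colon I\to X\otimes X^\vee$, and there is a pivotal structure, i.e. an isomorphism $j\colon X\to X^{\vee\vee}$ of monoidal functors. By means of $j$, the object $X^\vee$ is also a dual of $X$ on the other side, with morphisms $\mathrm{db}'=(\mathrm{id}\otimes j_X^{-1})\,\mathrm{db}_{X^\vee}\colon I\to X^\vee\otimes X$ and $\mathrm{ev}'=\mathrm{ev}_{X^\vee}(j_X\otimes\mathrm{id})\colon X\otimes X^\vee\to I$. Let $n\ge 1$ and $\ell,r\ge 0$ be integers, put $k_0=\ell+r+1$ and assume $k_0\le n$. For an object $V$ put $M=V^{\otimes(n-k_0)}$, $P=V^{\otimes\ell}$, $Q=V^{\otimes r}$. Let $(T,\iota,\pi)$ be a trivial component of $V^{\otimes n}$, i.e. $T$ is a finite direct sum of copies of $I$, and $\iota\colon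 T\to V^{\otimes n}$, $\pi\colon V^{\otimes n}\to T$ satisfy $\pi\iota=\mathrm{id}_T$ and exhibit $T$ as a direct summand of $V^{\otimes n}$ with a complement that is a direct sum of simple objects not isomorphic to $I$; trivial components exist. Let $\tau\colon X\otimes T\to T\otimes X$ be the isomorphism, natural in the object $X$ and in the direct sum $T$ of copies of $I$, which is the canonical one for $T=I$. The generalized Frobenius–Schur endomorphism $\mathrm{FS}_V^{(n,\ell,r)}\colon V\to V$ is the composite (associativity and unit isomorphisms suppressed) $$V\to P^\vee\otimes M^\vee\otimes \bigl(M\otimes P\otimes V\otimes Q\bigr)\otimes Q^\vee\xrightarrow{\ \pi\ }P^\vee\otimes M^\vee\otimes T\otimes Q^\vee\xrightarrow{\ \tau\ }P^\vee\otimes T\otimes M^\vee\otimes Q^\vee\xrightarrow{\ \iota\ }P^\vee\otimes \bigl(P\otimes V\otimes Q\otimes M\bigr)\otimes M^\vee\otimes Q^\vee\to V,$$ where the first arrow is built from $\mathrm{db}'\colon I\to P^\vee\otimes P$, $\mathrm{db}'\colon I\to M^\vee\otimes M$ and $\mathrm{db}\colon I\to Q\otimes Q^\vee$, where $M\otimes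 P\otimes V\otimes Q$ and $P\otimes V\otimes Q\otimes M$ are both identified with $V^{\otimes n}$ in the evident way (no permutation of tensor factors), and where the last arrow is built from $\mathrm{ev}\colon P^\vee\otimes P\to I$, $\mathrm{ev}'\colon M\otimes M^\vee\to I$ and $\mathrm{ev}'\colon Q\otimes Q^\vee\to I$. If $n$ and $k_0=\ell+r+1$ are relatively prime, then the endomorphisms $\mathrm{FS}_V^{(n,\ell,r)}$ (for any choice of the trivial components) are the components of a natural endomorphism of the identity functor of $\mathcal C$; that is, $f\circ\mathrm{FS}_V^{(n,\ell,r)}=\mathrm{FS}_W^{(n,\ell,r)}\circ f$ for every morphism $f\colon V\to W$. -/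

import Mathlib

open CategoryTheory MonoidalCategory Limits

universe w v u

noncomputable section

namespace FrobSchur

theorem replicate_split_left {α : Type u} (V : α) {n m l r : ℕ} (h : n = m + (l + (r + 1))) :
    List.replicate n V =
      List.replicate m V ++ (List.replicate l V ++ (V :: List.replicate r V)) := by
  subst h
  rw [← List.replicate_succ, List.replicate_append_replicate, List.replicate_append_replicate]

theorem replicate_split_right {α : Type u} (V : α) {n m l r : ℕ} (h : n = m + (l + (r + 1))) :
    List.replicate n V =
      List.replicate l V ++ (V :: (List.replicate r V ++ List.replicate m V)) := by
  subst h
  rw [List.replicate_append_replicate, ← List.replicate_succ, List.replicate_append_replicate]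
  congr 1
  omega

section TensorPowers

variable {C : Type u} [Category.{v} C] [MonoidalCategory C]

/-- The tensor product `X₁ ⊗ (X₂ ⊗ (⋯ ⊗ (Xₙ ⊗ 𝟙)))` of a list of objects, with rightmost
parentheses; the empty list gives the unit object. -/
def tensorList : List C → C
  | [] => 𝟙_ C
  | X :: L => X ⊗ tensorList L

/-- The canonical isomorphism (composed of associators and unitors only) which splits the tensor
product of a concatenated list. -/
def tensorListAppend : (L L' : List C) → (tensorList (L ++ L') ≅ tensorList L ⊗ tensorList L')
  | [], L' => (λ_ (tensorList L')).symm
  | X :: L, L' =>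
      whiskerLeftIso X (tensorListAppend L L') ≪≫ (α_ X (tensorList L) (tensorList L')).symm

/-- The tensor power `V^{⊗ n}`, with rightmost parentheses. -/
abbrev tpow (V : C) (n : ℕ) : C := tensorList (List.replicate n V)

/-- The canonical isomorphism `V^{⊗ n} ≅ V^{⊗ m} ⊗ V^{⊗ l} ⊗ V ⊗ V^{⊗ r}` (no permutation of the
tensor factors), for `n = m + l + r + 1`. -/
def splitLeft (V : C) {n m l r : ℕ} (h : n = m + (l + (r + 1))) :
    tpow V n ≅ tpow V m ⊗ (tpow V l ⊗ (V ⊗ tpow V r)) :=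
  eqToIso (congrArg tensorList (replicate_split_left V h)) ≪≫
    tensorListAppend (List.replicate m V) (List.replicate l V ++ (V :: List.replicate r V)) ≪≫
    whiskerLeftIso (tpow V m)
      (tensorListAppend (List.replicate l V) (V :: List.replicate r V))

/-- The canonical isomorphism `V^{⊗ n} ≅ V^{⊗ l} ⊗ V ⊗ V^{⊗ r} ⊗ V^{⊗ m}` (no permutation of the
tensor factors), for `n = m + l + r + 1`. -/
def splitRight (V : C) {n m l r : ℕ} (h : n = m + (l + (r + 1))) :
    tpow V n ≅ tpow V l ⊗ (V ⊗ (tpow V r ⊗ tpow V m)) :=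
  eqToIso (congrArg tensorList (replicate_split_right V h)) ≪≫
    tensorListAppend (List.replicate l V) (V :: (List.replicate r V ++ List.replicate m V)) ≪≫
    whiskerLeftIso (tpow V l)
      (whiskerLeftIso V (tensorListAppend (List.replicate r V) (List.replicate m V)))

end TensorPowers

section Pivotal

variable {C : Type u} [Category.{v} C] [MonoidalCategory C] [RightRigidCategory C]

/-- The chosen dual `X^∨` of `X`, with evaluation `X^∨ ⊗ X ⟶ 𝟙` and coevaluation
`𝟙 ⟶ X ⊗ X^∨`. (This is a right dual in Mathlib's terminology and a left dual in other texts.) -/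
abbrev du (X : C) : C := (RightRigidCategory.rightDual X).rightDual

/-- The duality between `X` and its chosen dual. -/
abbrev duPairing (X : C) : ExactPairing X (du X) := (RightRigidCategory.rightDual X).exact

/-- The evaluation `X^∨ ⊗ X ⟶ 𝟙`. -/
abbrev evDu (X : C) : du X ⊗ X ⟶ 𝟙_ C :=
  letI := duPairing X
  ε_ X (du X)

/-- The coevaluation `𝟙 ⟶ X ⊗ X^∨`. -/
abbrev coevDu (X : C) : 𝟙_ C ⟶ X ⊗ du X :=
  letI := duPairing X
  η_ X (du X)

/-- The dual (transpose) `f^∨ : Y^∨ ⟶ X^∨` of a morphism `f : X ⟶ Y`. -/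
abbrev duMap {X Y : C} (f : X ⟶ Y) : du Y ⟶ du X :=
  @rightAdjointMate C _ _ X Y (RightRigidCategory.rightDual X) (RightRigidCategory.rightDual Y) f

/-- The canonical isomorphism `W^∨ ⊗ V^∨ ≅ (V ⊗ W)^∨` given by uniqueness of duals. -/
def duTensor (V W : C) : du W ⊗ du V ≅ du (V ⊗ W) :=
  letI := duPairing V
  letI := duPairing W
  rightDualIso (X := V ⊗ W) ExactPairing.tensor (duPairing (V ⊗ W))

variable (C) in
/-- The canonical isomorphism `𝟙 ≅ 𝟙^∨` given by uniqueness of duals. -/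
def duUnit : 𝟙_ C ≅ du (𝟙_ C) :=
  rightDualIso (X := 𝟙_ C) exactPairingUnit (duPairing (𝟙_ C))

variable (C) in
/-- A pivotal structure: an isomorphism `j : V ≅ V^∨^∨` of monoidal functors. The structure
morphisms of the monoidal functor `(-)^∨^∨` are
`V^∨^∨ ⊗ W^∨^∨ ⟶ (W^∨ ⊗ V^∨)^∨ ⟶ (V ⊗ W)^∨^∨` and `𝟙 ⟶ 𝟙^∨ ⟶ 𝟙^∨^∨`. -/
structure PivotalStructure where
  /-- the components of the isomorphism -/
  iso : ∀ V : C, V ≅ du (du V)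
  naturality : ∀ {V W : C} (f : V ⟶ W), f ≫ (iso W).hom = (iso V).hom ≫ duMap (duMap f)
  tensor : ∀ V W : C, (iso (V ⊗ W)).hom =
    ((iso V).hom ⊗ₘ (iso W).hom) ≫ (duTensor (du W) (du V)).hom ≫ duMap (duTensor V W).inv
  unit : (iso (𝟙_ C)).hom = (duUnit C).hom ≫ duMap (duUnit C).inv

/-- The coevaluation `𝟙 ⟶ X^∨ ⊗ X^∨^∨ ⟶ X^∨ ⊗ X` which, with `PivotalStructure.ev`, makes `X^∨`
a dual of `X` on the other side. -/
def PivotalStructure.coev (j : PivotalStructure C) (X : C) : 𝟙_ C ⟶ du X ⊗ X :=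
  coevDu (du X) ≫ du X ◁ (j.iso X).inv

/-- The evaluation `X ⊗ X^∨ ⟶ X^∨^∨ ⊗ X^∨ ⟶ 𝟙` which, with `PivotalStructure.coev`, makes `X^∨`
a dual of `X` on the other side. -/
def PivotalStructure.ev (j : PivotalStructure C) (X : C) : X ⊗ du X ⟶ 𝟙_ C :=
  (j.iso X).hom ▷ du X ≫ evDu (du X)

end Pivotal

section Semisimple

attribute [local instance] Abelian.hasFiniteBiproducts

variable (k : Type w) [Field k] {C : Type u} [Category.{v} C] [Abelian C] [Linear k C]

/-- An (absolutely) simple object of a `k`-linear category: a simple object whose endomorphism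
ring is `k`. -/
structure IsSimpleObject (S : C) : Prop where
  simple : Simple S
  endo : Function.Bijective (fun c : k => c • 𝟙 S)

variable (C) in
/-- A `k`-linear abelian category is semisimple if every object is a (finite) direct sum of
simple objects. -/
def IsSemisimple : Prop :=
  ∀ X : C, ∃ (n : ℕ) (S : Fin n → C), (∀ i, IsSimpleObject k (S i)) ∧ Nonempty (X ≅ ⨁ S)

variable [MonoidalCategory C]

/-- A trivial component of `X`: the isotypical component of `X` for the unit object, given by an
object `obj` with an isomorphism to a direct sum of copies of the unit, together with
`inc : obj ⟶ X` and `proj : X ⟶ obj` which split `X` into `obj` and a direct sum of simple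
objects none of which is isomorphic to the unit. -/
structure TrivialComponent (X : C) where
  /-- the trivial object `X^triv` -/
  obj : C
  /-- the injection `X^triv ⟶ X` -/
  inc : obj ⟶ X
  /-- the projection `X ⟶ X^triv` -/
  proj : X ⟶ obj
  /-- the number of summands of `X^triv` -/
  mult : ℕ
  /-- a decomposition of `X^triv` into copies of the unit object -/
  decomp : obj ≅ ⨁ (fun _ : Fin mult => 𝟙_ C)
  inc_proj : inc ≫ proj = 𝟙 obj
  complement : ∃ (m : ℕ) (S : Fin m → C),
    (∀ i, IsSimpleObject k (S i) ∧ IsEmpty (S i ≅ 𝟙_ C)) ∧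
    ∃ (inc' : (⨁ S) ⟶ X) (proj' : X ⟶ ⨁ S),
      inc' ≫ proj' = 𝟙 (⨁ S) ∧ proj ≫ inc + proj' ≫ inc' = 𝟙 X

variable {k} in
/-- In a semisimple category every object has a trivial component. -/
theorem nonempty_trivialComponent (hC : IsSemisimple k C) (X : C) :
    Nonempty (TrivialComponent k X) := by
  classical
  obtain ⟨n, S, hS, ⟨e⟩⟩ := hC X
  let P : Fin n → Prop := fun i => Nonempty (S i ≅ 𝟙_ C)
  let σ := Fintype.equivFin {i // P i}
  let σ' := Fintype.equivFin {i // ¬ P i}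
  let u : ∀ i : {i // P i}, S i ≅ 𝟙_ C := fun i => i.2.some
  let m := Fintype.card {i // P i}
  let m' := Fintype.card {i // ¬ P i}
  let S' : Fin m' → C := fun i => S (σ'.symm i)
  refine ⟨⟨⨁ (fun _ : Fin m => 𝟙_ C),
    biproduct.desc (fun i => (u (σ.symm i)).inv ≫ biproduct.ι S (σ.symm i)) ≫ e.inv,
    e.hom ≫ biproduct.lift (fun i => biproduct.π S (σ.symm i) ≫ (u (σ.symm i)).hom),
    m, Iso.refl _, ?_, m', S', fun i => ⟨hS _, not_nonempty_iff.mp (σ'.symm i).2⟩,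
    biproduct.desc (fun i => biproduct.ι S (σ'.symm i)) ≫ e.inv,
    e.hom ≫ biproduct.lift (fun i => biproduct.π S (σ'.symm i)), ?_, ?_⟩⟩
  · ext i i'
    rcases eq_or_ne i i' with rfl | hne
    · simp
    · have : (σ.symm i : Fin n) ≠ σ.symm i' :=
        fun hh => hne (σ.symm.injective (Subtype.ext hh))
      simp [biproduct.ι_π_ne_assoc _ this.symm, biproduct.ι_π_ne _ hne.symm]
  · ext i i'
    rcases eq_or_ne i i' with rfl | hne
    · simp [S']
    · have : (σ'.symm i : Fin n) ≠ σ'.symm i' :=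
        fun hh => hne (σ'.symm.injective (Subtype.ext hh))
      rw [Category.id_comp, biproduct.ι_π_ne _ hne.symm]
      simp [S', biproduct.ι_π_ne _ this.symm]
  · rw [← cancel_epi e.inv, ← cancel_mono e.hom]
    simp only [Preadditive.comp_add, Preadditive.add_comp, Category.assoc, e.inv_hom_id,
      e.inv_hom_id_assoc, Category.comp_id]
    simp only [biproduct.lift_desc, Category.assoc,
      Iso.hom_inv_id_assoc]
    rw [σ.symm.sum_comp (fun i : {i // P i} => biproduct.π S i ≫ biproduct.ι S i),
      σ'.symm.sum_comp (fun i : {i // ¬ P i} => biproduct.π S i ≫ biproduct.ι S i),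
      Fintype.sum_subtype_add_sum_subtype P (fun i => biproduct.π S i ≫ biproduct.ι S i),
      biproduct.total]

/-- The canonical isomorphism `V ⊗ T ≅ T ⊗ V`, natural in `V` and in the trivial object `T`, which
for `T = 𝟙` is the composite of unitors. It is described by a decomposition of `T` into copies of
the unit with projections `p i : T ⟶ 𝟙` and injections `q i : 𝟙 ⟶ T`, namely as the sum of the
morphisms `V ⊗ T ⟶ V ⊗ 𝟙 ≅ 𝟙 ⊗ V ⟶ T ⊗ V` given by `p i` and `q i`. -/
def trivialBraiding (V : C) {T : C} {m : ℕ} (e : T ≅ ⨁ (fun _ : Fin m => 𝟙_ C)) :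
    V ⊗ T ⟶ T ⊗ V :=
  ∑ i : Fin m,
    V ◁ (e.hom ≫ biproduct.π (fun _ : Fin m => 𝟙_ C) i) ≫ (ρ_ V).hom ≫ (λ_ V).inv ≫
      (biproduct.ι (fun _ : Fin m => 𝟙_ C) i ≫ e.inv) ▷ V

end Semisimple

section FrobeniusSchur

variable {k : Type w} [Field k] {C : Type u} [Category.{v} C] [Abelian C] [Linear k C]
  [MonoidalCategory C] [RightRigidCategory C]

/-- The generalized Frobenius-Schur endomorphism `FS_V^{(n,l,r)}`, computed with a given trivial
component `t` of `V^{⊗ n}`. With `M = V^{⊗ (n - (l + r + 1))}`, `P = V^{⊗ l}`, `Q = V^{⊗ r}` it is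
the composite
`V ⟶ P^∨ ⊗ (M^∨ ⊗ M) ⊗ P ⊗ V ⊗ Q ⊗ Q^∨` (coevaluations),
`P^∨ ⊗ M^∨ ⊗ (M ⊗ P ⊗ V ⊗ Q) ⊗ Q^∨ ⟶ P^∨ ⊗ M^∨ ⊗ T ⊗ Q^∨` (projection of `V^{⊗ n}` to `T`),
`P^∨ ⊗ M^∨ ⊗ T ⊗ Q^∨ ⟶ P^∨ ⊗ T ⊗ M^∨ ⊗ Q^∨` (the isomorphism moving the trivial object `T`),
`P^∨ ⊗ T ⊗ M^∨ ⊗ Q^∨ ⟶ P^∨ ⊗ (P ⊗ V ⊗ Q ⊗ M) ⊗ M^∨ ⊗ Q^∨` (injection of `T` to `V^{⊗ n}`),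
`(P^∨ ⊗ P) ⊗ V ⊗ Q ⊗ (M ⊗ M^∨) ⊗ Q^∨ ⟶ V ⊗ Q ⊗ Q^∨ ⟶ V` (evaluations).
The symbol `⊗≫` is composition with canonical associators and unitors inserted. -/
def FS (j : PivotalStructure C) (n l r : ℕ) (h : l + r + 1 ≤ n) (V : C)
    (t : TrivialComponent k (tpow V n)) : V ⟶ V :=
  let m := n - (l + r + 1)
  have hn : n = m + (l + (r + 1)) := by omega
  let M := tpow V m
  let P := tpow V l
  let Q := tpow V r
  𝟙 V ⊗≫
    j.coev P ▷ V ⊗≫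
    (du P ⊗ P ⊗ V) ◁ coevDu Q ⊗≫
    du P ◁ j.coev M ▷ (P ⊗ V ⊗ Q ⊗ du Q) ⊗≫
    (du P ⊗ du M) ◁ ((splitLeft V hn).inv ≫ t.proj) ▷ du Q ⊗≫
    du P ◁ trivialBraiding (du M) t.decomp ▷ du Q ⊗≫
    du P ◁ (t.inc ≫ (splitRight V hn).hom) ▷ (du M ⊗ du Q) ⊗≫
    evDu P ▷ (V ⊗ Q ⊗ M ⊗ du M ⊗ du Q) ⊗≫
    (V ⊗ Q) ◁ j.ev M ▷ du Q ⊗≫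
    V ◁ j.ev Q ⊗≫
    𝟙 V

end FrobeniusSchur

end FrobSchur

end

noncomputable section

namespace FrobSchur

/-! ### Transposition of tensor factors and its naturality -/

section Transposes

variable {C : Type u} [Category.{v} C] [MonoidalCategory C] [RightRigidCategory C]

/-! Put `m = n - (l + r + 1)` and number tensor factors from 0. By Schur's lemma a trivial component
of `X` amounts to dual bases `coord i : X ⟶ 𝟙` and `basis i : 𝟙 ⟶ X`. The Frobenius-Schur
endomorphism becomes a sum over `i` of contractions of `coord i` with `basis i` (`FS_eq_sum`):
factor `p ≠ l` of `basis i` is joined by a strand to factor `p + m` modulo `n` of `coord i`, factor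
`m + l` of `coord i` is the input, and factor `l` of `basis i` is the output.

This makes sense for mixed words in `V` and `W`, provided that `f : V ⟶ W` is inserted on every
strand running from a `V` to a `W` and no strand runs from `W` to `V`. The canonical element `∑
coord i ⊗ basis i` is dinatural (`TrivialComponent.sum_comp_coord_basis`). Hence, if a word `w'`
arises from `w` by turning some `V` into `W`, and `w'` at `p ≠ l` is at most `w` at `p + m`, the
morphisms of the two words are intertwined by the maps of their input and output letters
(`wordFS_naturality`).

It remains to pass from the word of all `V` to the word of all `W`. The letters are changed at `l`,
`l - m`, `l - 2m`, … modulo `n`; whenever `p ≠ l` is changed, `p + m` has been changed before, so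
each step is admissible (`linked_filling`). As `n` and `l + r + 1` are coprime, so are `n` and `m`,
and `n` steps reach every position (`filling_self`). Over the whole chain the output letter and the
input letter each change once, which gives one `f` on either side. -/

theorem coevDu_comp_duMap {X Y : C} (f : X ⟶ Y) :
    coevDu X ≫ f ▷ du X = coevDu Y ≫ Y ◁ duMap f :=
  (coevaluation_comp_rightAdjointMate f).symm

theorem duMap_comp_evDu {X Y : C} (f : X ⟶ Y) :
    duMap f ▷ X ≫ evDu X = du Y ◁ f ≫ evDu Y :=
  rightAdjointMate_comp_evaluation f

theorem PivotalStructure.iso_inv_naturality (j : PivotalStructure C) {X Y : C} (f : X ⟶ Y) :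
    (j.iso X).inv ≫ f = duMap (duMap f) ≫ (j.iso Y).inv := by
  rw [Iso.inv_comp_eq, ← Category.assoc, Iso.eq_comp_inv, j.naturality]

/-- Naturality of `j` turns `f` into its double transpose, which slides around the ordinary
coevaluation of the dual. -/
theorem PivotalStructure.coev_comp (j : PivotalStructure C) {X Y : C} (f : X ⟶ Y) :
    j.coev X ≫ du X ◁ f = j.coev Y ≫ duMap f ▷ Y := by
  simp only [PivotalStructure.coev, Category.assoc]
  rw [← MonoidalCategory.whiskerLeft_comp, j.iso_inv_naturality,
    MonoidalCategory.whiskerLeft_comp, ← reassoc_of% (coevDu_comp_duMap (duMap f)),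
    whisker_exchange]

theorem PivotalStructure.comp_ev (j : PivotalStructure C) {X Y : C} (f : X ⟶ Y) :
    X ◁ duMap f ≫ j.ev X = f ▷ du Y ≫ j.ev Y := by
  simp only [PivotalStructure.ev]
  rw [← comp_whiskerRight_assoc, j.naturality, comp_whiskerRight_assoc, duMap_comp_evDu,
    whisker_exchange_assoc]

/-- Transposition of a left tensor factor of the source to the target. -/
def moveLeft (j : PivotalStructure C) {M Z U : C} (g : M ⊗ Z ⟶ U) : Z ⟶ du M ⊗ U :=
  (λ_ Z).inv ≫ j.coev M ▷ Z ≫ (α_ _ _ _).hom ≫ du M ◁ g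

/-- Transposition of a right tensor factor of the source to the target. -/
def moveRight {Z Q U : C} (g : Z ⊗ Q ⟶ U) : Z ⟶ U ⊗ du Q :=
  (ρ_ Z).inv ≫ Z ◁ coevDu Q ≫ (α_ _ _ _).inv ≫ g ▷ du Q

/-- Transposition of a left tensor factor of the target to the source. -/
def unmoveLeft {P Z U : C} (g : U ⟶ P ⊗ Z) : du P ⊗ U ⟶ Z :=
  du P ◁ g ≫ (α_ _ _ _).inv ≫ evDu P ▷ Z ≫ (λ_ Z).hom

/-- Transposition of a right tensor factor of the target to the source. -/
def unmoveRight (j : PivotalStructure C) {Z Q U : C} (g : U ⟶ Z ⊗ Q) : U ⊗ du Q ⟶ Z :=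
  g ▷ du Q ≫ (α_ _ _ _).hom ≫ Z ◁ j.ev Q ≫ (ρ_ Z).hom

section Naturality

variable (j : PivotalStructure C)

theorem moveLeft_comp {M Z U U' : C} (g : M ⊗ Z ⟶ U) (u : U ⟶ U') :
    moveLeft j (g ≫ u) = moveLeft j g ≫ du M ◁ u := by
  simp [moveLeft]

theorem moveLeft_whiskerRight {M M' Z U : C} (a : M ⟶ M') (g : M' ⊗ Z ⟶ U) :
    moveLeft j (a ▷ Z ≫ g) = moveLeft j g ≫ duMap a ▷ U := by
  have h : j.coev M ▷ Z ≫ (α_ _ _ _).hom ≫ du M ◁ (a ▷ Z) =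
      j.coev M' ▷ Z ≫ (α_ _ _ _).hom ≫ duMap a ▷ (M' ⊗ Z) := by
    rw [← associator_naturality_middle, ← associator_naturality_left, ← comp_whiskerRight_assoc,
      ← comp_whiskerRight_assoc, j.coev_comp]
  simp only [moveLeft, MonoidalCategory.whiskerLeft_comp, Category.assoc]
  rw [reassoc_of% h, whisker_exchange]

theorem moveLeft_whiskerLeft {M Z Z' U : C} (z : Z ⟶ Z') (g : M ⊗ Z' ⟶ U) :
    moveLeft j (M ◁ z ≫ g) = z ≫ moveLeft j g := by
  simp only [moveLeft, MonoidalCategory.whiskerLeft_comp]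
  rw [← associator_naturality_right_assoc, ← whisker_exchange_assoc,
    ← leftUnitor_inv_naturality_assoc]

theorem moveLeft_tensorHom {M M' Z Z' U : C} (a : M ⟶ M') (z : Z ⟶ Z') (g : M' ⊗ Z' ⟶ U) :
    moveLeft j ((a ⊗ₘ z) ≫ g) = z ≫ moveLeft j g ≫ duMap a ▷ U := by
  rw [MonoidalCategory.tensorHom_def', Category.assoc, moveLeft_whiskerLeft,
    moveLeft_whiskerRight]

theorem moveRight_comp {Z Q U U' : C} (g : Z ⊗ Q ⟶ U) (u : U ⟶ U') :
    moveRight (g ≫ u) = moveRight g ≫ u ▷ du Q := by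
  simp [moveRight]

theorem moveRight_whiskerLeft {Z Q Q' U : C} (a : Q ⟶ Q') (g : Z ⊗ Q' ⟶ U) :
    moveRight (Z ◁ a ≫ g) = moveRight g ≫ U ◁ duMap a := by
  have h : Z ◁ coevDu Q ≫ (α_ _ _ _).inv ≫ (Z ◁ a) ▷ du Q =
      Z ◁ coevDu Q' ≫ (α_ _ _ _).inv ≫ (Z ⊗ Q') ◁ duMap a := by
    rw [← associator_inv_naturality_middle, ← associator_inv_naturality_right,
      ← MonoidalCategory.whiskerLeft_comp_assoc, ← MonoidalCategory.whiskerLeft_comp_assoc,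
      coevDu_comp_duMap]
  simp only [moveRight, comp_whiskerRight, Category.assoc]
  rw [reassoc_of% h, whisker_exchange]

theorem moveRight_whiskerRight {Z Z' Q U : C} (z : Z ⟶ Z') (g : Z' ⊗ Q ⟶ U) :
    moveRight (z ▷ Q ≫ g) = z ≫ moveRight g := by
  simp only [moveRight, comp_whiskerRight]
  rw [← associator_inv_naturality_left_assoc, whisker_exchange_assoc,
    ← rightUnitor_inv_naturality_assoc]

theorem moveRight_tensorHom {Z Z' Q Q' U : C} (z : Z ⟶ Z') (a : Q ⟶ Q') (g : Z' ⊗ Q' ⟶ U) :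
    moveRight ((z ⊗ₘ a) ≫ g) = z ≫ moveRight g ≫ U ◁ duMap a := by
  rw [MonoidalCategory.tensorHom_def, Category.assoc, moveRight_whiskerRight,
    moveRight_whiskerLeft]

theorem comp_unmoveLeft {P Z U U' : C} (u : U' ⟶ U) (g : U ⟶ P ⊗ Z) :
    unmoveLeft (u ≫ g) = du P ◁ u ≫ unmoveLeft g := by
  simp [unmoveLeft]

theorem unmoveLeft_whiskerRight {P P' Z U : C} (g : U ⟶ P ⊗ Z) (a : P ⟶ P') :
    unmoveLeft (g ≫ a ▷ Z) = duMap a ▷ U ≫ unmoveLeft g := by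
  have h : du P' ◁ (a ▷ Z) ≫ (α_ _ _ _).inv ≫ evDu P' ▷ Z =
      duMap a ▷ (P ⊗ Z) ≫ (α_ _ _ _).inv ≫ evDu P ▷ Z := by
    rw [associator_inv_naturality_middle_assoc, associator_inv_naturality_left_assoc,
      ← comp_whiskerRight, ← comp_whiskerRight, duMap_comp_evDu]
  simp only [unmoveLeft, MonoidalCategory.whiskerLeft_comp, Category.assoc]
  rw [reassoc_of% h, whisker_exchange_assoc]

theorem unmoveLeft_whiskerLeft {P Z Z' U : C} (g : U ⟶ P ⊗ Z) (z : Z ⟶ Z') :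
    unmoveLeft (g ≫ P ◁ z) = unmoveLeft g ≫ z := by
  simp only [unmoveLeft, MonoidalCategory.whiskerLeft_comp, Category.assoc]
  rw [associator_inv_naturality_right_assoc, whisker_exchange_assoc, leftUnitor_naturality]

theorem unmoveLeft_tensorHom {P P' Z Z' U : C} (g : U ⟶ P ⊗ Z) (a : P ⟶ P') (z : Z ⟶ Z') :
    unmoveLeft (g ≫ (a ⊗ₘ z)) = duMap a ▷ U ≫ unmoveLeft g ≫ z := by
  rw [MonoidalCategory.tensorHom_def, ← Category.assoc, unmoveLeft_whiskerLeft,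
    unmoveLeft_whiskerRight, Category.assoc]

theorem comp_unmoveRight {Z Q U U' : C} (u : U' ⟶ U) (g : U ⟶ Z ⊗ Q) :
    unmoveRight j (u ≫ g) = u ▷ du Q ≫ unmoveRight j g := by
  simp [unmoveRight]

theorem unmoveRight_whiskerLeft {Z Q Q' U : C} (g : U ⟶ Z ⊗ Q) (a : Q ⟶ Q') :
    unmoveRight j (g ≫ Z ◁ a) = U ◁ duMap a ≫ unmoveRight j g := by
  have h : (Z ◁ a) ▷ du Q' ≫ (α_ _ _ _).hom ≫ Z ◁ j.ev Q' =
      (Z ⊗ Q) ◁ duMap a ≫ (α_ _ _ _).hom ≫ Z ◁ j.ev Q := by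
    rw [associator_naturality_middle_assoc, associator_naturality_right_assoc,
      ← MonoidalCategory.whiskerLeft_comp, ← MonoidalCategory.whiskerLeft_comp, j.comp_ev]
  simp only [unmoveRight, comp_whiskerRight, Category.assoc]
  rw [reassoc_of% h, whisker_exchange_assoc]

theorem unmoveRight_whiskerRight {Z Z' Q U : C} (g : U ⟶ Z ⊗ Q) (z : Z ⟶ Z') :
    unmoveRight j (g ≫ z ▷ Q) = unmoveRight j g ≫ z := by
  simp only [unmoveRight, comp_whiskerRight, Category.assoc]
  rw [associator_naturality_left_assoc, ← whisker_exchange_assoc, rightUnitor_naturality]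

theorem unmoveRight_tensorHom {Z Z' Q Q' U : C} (g : U ⟶ Z ⊗ Q) (z : Z ⟶ Z') (a : Q ⟶ Q') :
    unmoveRight j (g ≫ (z ⊗ₘ a)) = U ◁ duMap a ≫ unmoveRight j g ≫ z := by
  rw [MonoidalCategory.tensorHom_def', ← Category.assoc, unmoveRight_whiskerRight,
    unmoveRight_whiskerLeft, Category.assoc]

end Naturality

/-- The part of the Frobenius-Schur composite before the trivial object is moved. -/
def FSsource (j : PivotalStructure C) {M P A Q U : C} (φ : M ⊗ (P ⊗ (A ⊗ Q)) ⟶ U) :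
    A ⟶ (du P ⊗ (du M ⊗ U)) ⊗ du Q :=
  moveRight (moveLeft j (moveLeft j φ))

/-- The part of the Frobenius-Schur composite after the trivial object is moved. -/
def FStarget (j : PivotalStructure C) {M P B Q U : C} (ψ : U ⟶ P ⊗ (B ⊗ (Q ⊗ M))) :
    ((du P ⊗ U) ⊗ du M) ⊗ du Q ⟶ B :=
  unmoveRight j (unmoveRight j (unmoveLeft ψ ≫ (α_ _ _ _).inv))

theorem FSsource_comp (j : PivotalStructure C) {M P A Q U U' : C}
    (φ : M ⊗ (P ⊗ (A ⊗ Q)) ⟶ U) (u : U ⟶ U') :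
    FSsource j (φ ≫ u) = FSsource j φ ≫ (du P ◁ du M ◁ u) ▷ du Q := by
  simp only [FSsource, moveLeft_comp, moveRight_comp]

theorem comp_FStarget (j : PivotalStructure C) {M P B Q U U' : C}
    (u : U' ⟶ U) (ψ : U ⟶ P ⊗ (B ⊗ (Q ⊗ M))) :
    FStarget j (u ≫ ψ) = ((du P ◁ u) ▷ du M) ▷ du Q ≫ FStarget j ψ := by
  simp only [FStarget, comp_unmoveLeft, comp_unmoveRight, Category.assoc]

/-- Only the map on the input letter stays a factor; the maps on the bent factors come out as
transposes, ready to travel along the strands. -/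
theorem FSsource_tensorHom (j : PivotalStructure C) {M P A Q M' P' A' Q' U : C}
    (a : M ⟶ M') (b : P ⟶ P') (x : A ⟶ A') (c : Q ⟶ Q') (φ : M' ⊗ (P' ⊗ (A' ⊗ Q')) ⟶ U) :
    FSsource j ((a ⊗ₘ (b ⊗ₘ (x ⊗ₘ c))) ≫ φ) =
      x ≫ FSsource j φ ≫ ((duMap b ⊗ₘ (duMap a ▷ U)) ⊗ₘ duMap c) := by
  simp only [FSsource]
  rw [moveLeft_tensorHom, moveLeft_tensorHom, moveRight_tensorHom, moveLeft_comp, Category.assoc,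
    moveRight_comp, Category.assoc, ← MonoidalCategory.tensorHom_def',
    ← MonoidalCategory.tensorHom_def]

theorem FStarget_tensorHom (j : PivotalStructure C) {M P B Q M' P' B' Q' U : C}
    (b : P ⟶ P') (x : B ⟶ B') (c : Q ⟶ Q') (a : M ⟶ M') (ψ : U ⟶ P ⊗ (B ⊗ (Q ⊗ M))) :
    FStarget j (ψ ≫ (b ⊗ₘ (x ⊗ₘ (c ⊗ₘ a)))) =
      (((duMap b ▷ U) ⊗ₘ duMap a) ⊗ₘ duMap c) ≫ FStarget j ψ ≫ x := by
  simp only [FStarget, unmoveLeft_tensorHom, Category.assoc, associator_inv_naturality]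
  rw [comp_unmoveRight, ← Category.assoc (unmoveLeft ψ), unmoveRight_tensorHom,
    ← Category.assoc, ← Category.assoc, unmoveRight_tensorHom, comp_unmoveRight,
    ← MonoidalCategory.tensorHom_def]
  simp only [MonoidalCategory.tensorHom_def', Category.assoc]

end Transposes

/-! ### The Frobenius-Schur composite as iterated transposition -/

section FrobeniusSchur

attribute [local instance] Abelian.hasFiniteBiproducts

variable {k : Type w} [Field k] {C : Type u} [Category.{v} C] [Abelian C] [Linear k C]
  [MonoidalCategory C] [RightRigidCategory C]

theorem FS_eq_source_target (j : PivotalStructure C) (n l r : ℕ) (h : l + r + 1 ≤ n) (V : C)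
    (t : TrivialComponent k (tpow V n)) :
    FS j n l r h V t =
      FSsource j ((splitLeft V (by omega : n = (n - (l + r + 1)) + (l + (r + 1)))).inv ≫ t.proj) ≫
        (du (tpow V l) ◁ trivialBraiding (du (tpow V (n - (l + r + 1)))) t.decomp ≫
          (α_ _ _ _).inv) ▷ du (tpow V r) ≫
        FStarget j (t.inc ≫
          (splitRight V (by omega : n = (n - (l + r + 1)) + (l + (r + 1)))).hom) := by
  unfold FS FSsource FStarget moveLeft moveRight unmoveLeft unmoveRight
  extract_lets m hn M P Q
  generalize (splitLeft V hn).inv ≫ t.proj = φ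
  generalize t.inc ≫ (splitRight V hn).hom = ψ
  generalize trivialBraiding (du M) t.decomp = τ
  -- `FS` creates `P` before `Q`, while `FSsource` creates `Q` first. Exchanging the two is the
  -- interchange law; all the rest is coherence.
  have h₁ : j.coev P ▷ V ≫ (du P ⊗ P) ◁ (ρ_ V).inv ≫ (du P ⊗ P) ◁ V ◁ coevDu Q =
      (λ_ V).hom ≫ (ρ_ V).inv ≫ V ◁ coevDu Q ≫ (λ_ _).inv ≫ j.coev P ▷ (V ⊗ Q ⊗ du Q) := by
    rw [← whisker_exchange_assoc, ← whisker_exchange]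
    monoidal
  calc
    _ = 𝟙 V ⊗≫ (j.coev P ▷ V ≫ (du P ⊗ P) ◁ (ρ_ V).inv ≫ (du P ⊗ P) ◁ V ◁ coevDu Q) ⊗≫
          du P ◁ j.coev M ▷ (P ⊗ V ⊗ Q ⊗ du Q) ⊗≫ (du P ⊗ du M) ◁ φ ▷ du Q ⊗≫
          du P ◁ τ ▷ du Q ⊗≫ du P ◁ ψ ▷ (du M ⊗ du Q) ⊗≫
          evDu P ▷ (V ⊗ Q ⊗ M ⊗ du M ⊗ du Q) ⊗≫ (V ⊗ Q) ◁ j.ev M ▷ du Q ⊗≫ V ◁ j.ev Q ⊗≫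
          𝟙 V := by monoidal
    _ = _ := by
      rw [h₁]
      monoidal

end FrobeniusSchur

/-! ### Dual bases from a trivial component -/

section DualBases

attribute [local instance] Abelian.hasFiniteBiproducts

variable {k : Type w} [Field k] {C : Type u} [Category.{v} C] [Abelian C] [Linear k C]
  [MonoidalCategory C]

namespace TrivialComponent

variable {X Y : C}

/-- The coordinate projections of `X` to the copies of the unit in its trivial component. -/
def coord (t : TrivialComponent k X) (i : Fin t.mult) : X ⟶ 𝟙_ C :=
  t.proj ≫ t.decomp.hom ≫ biproduct.π _ i

/-- The inclusions into `X` of the copies of the unit in its trivial component. -/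
def basis (t : TrivialComponent k X) (i : Fin t.mult) : 𝟙_ C ⟶ X :=
  biproduct.ι (fun _ : Fin t.mult => 𝟙_ C) i ≫ t.decomp.inv ≫ t.inc

theorem sum_coord_basis (t : TrivialComponent k X) :
    ∑ i, t.coord i ≫ t.basis i = t.proj ≫ t.inc := by
  have h : ∑ i, t.coord i ≫ t.basis i = t.proj ≫ t.decomp.hom ≫
      (∑ i, biproduct.π (fun _ : Fin t.mult => 𝟙_ C) i ≫
        biproduct.ι (fun _ : Fin t.mult => 𝟙_ C) i) ≫
        t.decomp.inv ≫ t.inc := by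
    simp only [coord, basis, Preadditive.comp_sum, Preadditive.sum_comp, Category.assoc]
  rw [h, biproduct.total, Category.id_comp, Iso.hom_inv_id_assoc]

/-- By Schur's lemma `φ` vanishes on the complement, so it factors through the idempotent `t.proj ≫
t.inc`, which is the sum of the `coord i ≫ basis i`. -/
theorem eq_sum_coord_comp (hunit : IsSimpleObject k (𝟙_ C)) (t : TrivialComponent k X)
    (φ : X ⟶ 𝟙_ C) : φ = ∑ i, t.coord i ≫ t.basis i ≫ φ := by
  obtain ⟨m, S, hS, inc', proj', -, h⟩ := t.complement
  have h0 : inc' ≫ φ = 0 := by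
    ext i
    have := hunit.simple
    have := (hS i).1.simple
    rw [comp_zero]
    by_contra hne
    have := isIso_of_hom_simple hne
    exact (hS i).2.elim (asIso (biproduct.ι S i ≫ inc' ≫ φ))
  simp only [← Category.assoc]
  rw [← Preadditive.sum_comp, sum_coord_basis]
  calc φ = (t.proj ≫ t.inc + proj' ≫ inc') ≫ φ := by rw [h, Category.id_comp]
    _ = _ := by simp [h0]

theorem eq_sum_comp_basis (hunit : IsSimpleObject k (𝟙_ C)) (t : TrivialComponent k X)
    (ψ : 𝟙_ C ⟶ X) : ψ = ∑ i, (ψ ≫ t.coord i) ≫ t.basis i := by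
  obtain ⟨m, S, hS, inc', proj', -, h⟩ := t.complement
  have h0 : ψ ≫ proj' = 0 := by
    ext i
    have := hunit.simple
    have := (hS i).1.simple
    rw [zero_comp]
    by_contra hne
    have := isIso_of_hom_simple hne
    exact (hS i).2.elim (asIso ((ψ ≫ proj') ≫ biproduct.π S i)).symm
  simp only [Category.assoc]
  rw [← Preadditive.comp_sum, sum_coord_basis]
  calc ψ = ψ ≫ (t.proj ≫ t.inc + proj' ≫ inc') := by rw [h, Category.comp_id]
    _ = _ := by simp [reassoc_of% h0]

/-- The canonical element `∑ i, coord i ⊗ basis i` is dinatural. -/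
theorem sum_comp_coord_basis (hunit : IsSimpleObject k (𝟙_ C)) (t : TrivialComponent k X)
    (t' : TrivialComponent k Y) (F : X ⟶ Y) {H : Type*} [AddCommGroup H] [Module k H]
    (K : (X ⟶ 𝟙_ C) →ₗ[k] (𝟙_ C ⟶ Y) →ₗ[k] H) :
    ∑ a, K (F ≫ t'.coord a) (t'.basis a) = ∑ b, K (t.coord b) (t.basis b ≫ F) := by
  -- Endomorphisms of the unit are scalars. The scalars of `t.basis b ≫ F ≫ t'.coord a` form one
  -- matrix, which expresses both `F ≫ t'.coord a` and `t.basis b ≫ F`; bilinearity of `K` then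
  -- makes the two sums agree.
  choose c hc using fun g : 𝟙_ C ⟶ 𝟙_ C => hunit.endo.2 g
  simp only at hc
  have h₁ (a) : F ≫ t'.coord a =
      ∑ b, c (t.basis b ≫ F ≫ t'.coord a) • t.coord b := by
    rw [t.eq_sum_coord_comp hunit (F ≫ t'.coord a)]
    refine Finset.sum_congr rfl fun b _ => ?_
    conv_lhs => rw [← hc (t.basis b ≫ F ≫ t'.coord a)]
    simp [← t.eq_sum_coord_comp hunit]
  have h₂ (b) : t.basis b ≫ F =
      ∑ a, c (t.basis b ≫ F ≫ t'.coord a) • t'.basis a := by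
    rw [t'.eq_sum_comp_basis hunit (t.basis b ≫ F)]
    refine Finset.sum_congr rfl fun a _ => ?_
    conv_lhs => rw [Category.assoc (t.basis b), ← hc (t.basis b ≫ F ≫ t'.coord a)]
    simp
  simp_rw [h₂]
  conv_lhs => enter [2, a]; rw [h₁ a]
  simp only [map_sum, map_smul, LinearMap.sum_apply, LinearMap.smul_apply]
  exact Finset.sum_comm

end TrivialComponent

end DualBases

/-! ### Contraction of a functional with an invariant along strands -/

section Pairing

section

variable {C : Type u} [Category.{v} C] [MonoidalCategory C] [RightRigidCategory C]

theorem duMap_comp {X Y Z : C} (f : X ⟶ Y) (g : Y ⟶ Z) :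
    duMap (f ≫ g) = duMap g ≫ duMap f :=
  comp_rightAdjointMate

theorem duMap_id (X : C) : duMap (𝟙 X) = 𝟙 (du X) :=
  rightAdjointMate_id

/-- The middle part of the Frobenius-Schur composite for the trivial object `𝟙`, with transposes
of morphisms inserted on the duals. -/
def FSjunction {M P Q M' P' Q' : C} (a : M' ⟶ M) (b : P' ⟶ P) (c : Q' ⟶ Q) :
    (du P ⊗ (du M ⊗ 𝟙_ C)) ⊗ du Q ⟶ ((du P' ⊗ 𝟙_ C) ⊗ du M') ⊗ du Q' :=
  (du P ◁ ((ρ_ (du M)).hom ≫ (λ_ (du M)).inv) ≫ (α_ _ _ _).inv) ▷ du Q ≫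
    (((duMap b ▷ 𝟙_ C) ⊗ₘ duMap a) ⊗ₘ duMap c)

/-- Transposes arriving at the source end pass the unit object and merge with the morphisms already
on the strands. With `FSjunction_comp` for the other end, a morphism may be absorbed from either end
of a strand. -/
theorem comp_FSjunction {M P Q M' P' Q' M'' P'' Q'' : C} (a : M' ⟶ M) (b : P' ⟶ P) (c : Q' ⟶ Q)
    (a' : M'' ⟶ M') (b' : P'' ⟶ P') (c' : Q'' ⟶ Q') :
    ((duMap b ⊗ₘ (duMap a ▷ 𝟙_ C)) ⊗ₘ duMap c) ≫ FSjunction a' b' c' =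
      FSjunction (a' ≫ a) (b' ≫ b) (c' ≫ c) := by
  simp only [FSjunction, duMap_comp]
  generalize duMap a = a
  generalize duMap b = b
  generalize duMap c = c
  generalize duMap a' = a'
  generalize duMap b' = b'
  generalize duMap c' = c'
  have h₁ : a ▷ 𝟙_ C ≫ (ρ_ (du M')).hom ≫ (λ_ (du M')).inv =
      ((ρ_ (du M)).hom ≫ (λ_ (du M)).inv) ≫ 𝟙_ C ◁ a := by simp
  have h₂ : (b ⊗ₘ a ▷ 𝟙_ C) ≫ du P' ◁ ((ρ_ (du M')).hom ≫ (λ_ (du M')).inv) ≫ (α_ _ _ _).inv =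
      (du P ◁ ((ρ_ (du M)).hom ≫ (λ_ (du M)).inv) ≫ (α_ _ _ _).inv) ≫ (b ▷ 𝟙_ C ⊗ₘ a) := by
    rw [Category.assoc (du P ◁ _), ← tensorHom_id b, ← associator_inv_naturality,
      ← id_tensorHom (du P'), tensorHom_comp_tensorHom_assoc, h₁, ← id_tensorHom (du P),
      tensorHom_comp_tensorHom_assoc, id_tensorHom, Category.comp_id, Category.id_comp]
  rw [← tensorHom_id (_ ≫ _), tensorHom_comp_tensorHom_assoc, h₂, ← tensorHom_id (_ ≫ _),
    tensorHom_comp_tensorHom, tensorHom_comp_tensorHom]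
  simp only [Category.assoc, tensorHom_comp_tensorHom, comp_whiskerRight, Category.id_comp,
    Category.comp_id]

theorem FSjunction_comp {M P Q M' P' Q' M'' P'' Q'' : C} (a : M' ⟶ M) (b : P' ⟶ P) (c : Q' ⟶ Q)
    (a' : M'' ⟶ M') (b' : P'' ⟶ P') (c' : Q'' ⟶ Q') :
    FSjunction a b c ≫ (((duMap b' ▷ 𝟙_ C) ⊗ₘ duMap a') ⊗ₘ duMap c') =
      FSjunction (a' ≫ a) (b' ≫ b) (c' ≫ c) := by
  simp only [FSjunction, duMap_comp, Category.assoc, tensorHom_comp_tensorHom, comp_whiskerRight]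

/-- The contraction of `φ : M ⊗ P ⊗ A ⊗ Q ⟶ 𝟙` with `ψ : 𝟙 ⟶ P' ⊗ B ⊗ Q' ⊗ M'` along morphisms
`M' ⟶ M`, `P' ⟶ P` and `Q' ⟶ Q`. -/
def FSpair (j : PivotalStructure C) {M P Q M' P' Q' A B : C}
    (a : M' ⟶ M) (b : P' ⟶ P) (c : Q' ⟶ Q)
    (φ : M ⊗ (P ⊗ (A ⊗ Q)) ⟶ 𝟙_ C) (ψ : 𝟙_ C ⟶ P' ⊗ (B ⊗ (Q' ⊗ M'))) : A ⟶ B :=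
  FSsource j φ ≫ FSjunction a b c ≫ FStarget j ψ

theorem FSpair_comp_left (j : PivotalStructure C) {M P Q M' P' Q' M₁ P₁ Q₁ A B A₁ : C}
    (a : M' ⟶ M) (b : P' ⟶ P) (c : Q' ⟶ Q) (a₁ : M ⟶ M₁) (b₁ : P ⟶ P₁) (x : A ⟶ A₁) (c₁ : Q ⟶ Q₁)
    (φ : M₁ ⊗ (P₁ ⊗ (A₁ ⊗ Q₁)) ⟶ 𝟙_ C) (ψ : 𝟙_ C ⟶ P' ⊗ (B ⊗ (Q' ⊗ M'))) :
    FSpair j a b c ((a₁ ⊗ₘ (b₁ ⊗ₘ (x ⊗ₘ c₁))) ≫ φ) ψ =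
      x ≫ FSpair j (a ≫ a₁) (b ≫ b₁) (c ≫ c₁) φ ψ := by
  simp only [FSpair, FSsource_tensorHom, Category.assoc]
  rw [← comp_FSjunction, Category.assoc]

theorem FSpair_comp_right (j : PivotalStructure C) {M P Q M' P' Q' M₁ P₁ Q₁ A B B₁ : C}
    (a : M' ⟶ M) (b : P' ⟶ P) (c : Q' ⟶ Q) (a₁ : M₁ ⟶ M') (b₁ : P₁ ⟶ P') (x : B₁ ⟶ B)
    (c₁ : Q₁ ⟶ Q') (φ : M ⊗ (P ⊗ (A ⊗ Q)) ⟶ 𝟙_ C) (ψ : 𝟙_ C ⟶ P₁ ⊗ (B₁ ⊗ (Q₁ ⊗ M₁))) :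
    FSpair j a b c φ (ψ ≫ (b₁ ⊗ₘ (x ⊗ₘ (c₁ ⊗ₘ a₁)))) =
      FSpair j (a₁ ≫ a) (b₁ ≫ b) (c₁ ≫ c) φ ψ ≫ x := by
  simp only [FSpair, FStarget_tensorHom, Category.assoc]
  rw [← FSjunction_comp, Category.assoc]

theorem FSsource_comp_FStarget (j : PivotalStructure C) {M P Q A B T : C}
    (φ : M ⊗ (P ⊗ (A ⊗ Q)) ⟶ T) (p : T ⟶ 𝟙_ C) (q : 𝟙_ C ⟶ T) (ψ : T ⟶ P ⊗ (B ⊗ (Q ⊗ M))) :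
    FSsource j φ ≫
      (du P ◁ (du M ◁ p ≫ (ρ_ (du M)).hom ≫ (λ_ (du M)).inv ≫ q ▷ du M) ≫
        (α_ _ _ _).inv) ▷ du Q ≫ FStarget j ψ =
      FSpair j (𝟙 M) (𝟙 P) (𝟙 Q) (φ ≫ p) (q ≫ ψ) := by
  simp only [FSpair, FSjunction, duMap_id, id_whiskerRight, id_tensorHom_id, Category.comp_id,
    FSsource_comp, comp_FStarget, Category.assoc, ← comp_whiskerRight_assoc,
    ← associator_inv_naturality_middle, MonoidalCategory.whiskerLeft_comp]

end

section Linear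

variable {k : Type w} [Field k] {C : Type u} [Category.{v} C] [Preadditive C] [Linear k C]
  [MonoidalCategory C] [MonoidalPreadditive C] [MonoidalLinear k C] [RightRigidCategory C]

variable (k) in
/-- `FSpair` as a bilinear map, precomposed with morphisms to the source of `φ` and from the target
of `ψ`. -/
def FSpairₗ (j : PivotalStructure C) {M P Q M' P' Q' A B X Y : C}
    (a : M' ⟶ M) (b : P' ⟶ P) (c : Q' ⟶ Q)
    (s : M ⊗ (P ⊗ (A ⊗ Q)) ⟶ X) (s' : Y ⟶ P' ⊗ (B ⊗ (Q' ⊗ M'))) :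
    (X ⟶ 𝟙_ C) →ₗ[k] (𝟙_ C ⟶ Y) →ₗ[k] (A ⟶ B) :=
  LinearMap.mk₂ k (fun φ ψ => FSpair j a b c (s ≫ φ) (ψ ≫ s'))
    (by
      intros
      simp [FSpair, FSsource, moveLeft, moveRight, MonoidalPreadditive.whiskerLeft_add,
        MonoidalPreadditive.add_whiskerRight])
    (by
      intros
      simp [FSpair, FSsource, moveLeft, moveRight])
    (by
      intros
      simp [FSpair, FStarget, unmoveLeft, unmoveRight, MonoidalPreadditive.whiskerLeft_add,
        MonoidalPreadditive.add_whiskerRight])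
    (by
      intros
      simp [FSpair, FStarget, unmoveLeft, unmoveRight])

end Linear

variable {k : Type w} [Field k] {C : Type u} [Category.{v} C] [Abelian C] [Linear k C]
  [MonoidalCategory C] [MonoidalPreadditive C] [RightRigidCategory C]

theorem FS_eq_sum (j : PivotalStructure C) (n l r : ℕ) (h : l + r + 1 ≤ n) (V : C)
    (t : TrivialComponent k (tpow V n)) :
    FS j n l r h V t = ∑ i, FSpair j (𝟙 _) (𝟙 _) (𝟙 _)
      ((splitLeft V (by omega : n = (n - (l + r + 1)) + (l + (r + 1)))).inv ≫ t.coord i)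
      (t.basis i ≫ (splitRight V (by omega : n = (n - (l + r + 1)) + (l + (r + 1)))).hom) := by
  rw [FS_eq_source_target]
  simp only [trivialBraiding, whiskerLeft_sum, sum_whiskerRight, Preadditive.sum_comp,
    Preadditive.comp_sum, FSsource_comp_FStarget]
  simp only [TrivialComponent.coord, TrivialComponent.basis, Category.assoc]

end Pairing

/-! ### Tensor products of words and letterwise maps -/

section Words

variable {C : Type u} [Category.{v} C] [MonoidalCategory C]

/-- The splitting `L ≅ M ⊗ P ⊗ A ⊗ Q` of the tensor product of a concatenated list. -/
def listSplitLeft {L M P Q : List C} {A : C} (h : L = M ++ (P ++ (A :: Q))) :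
    tensorList L ≅ tensorList M ⊗ (tensorList P ⊗ (A ⊗ tensorList Q)) :=
  eqToIso (congrArg tensorList h) ≪≫ tensorListAppend M (P ++ (A :: Q)) ≪≫
    whiskerLeftIso (tensorList M) (tensorListAppend P (A :: Q))

/-- The splitting `L ≅ P ⊗ B ⊗ Q ⊗ M` of the tensor product of a concatenated list. -/
def listSplitRight {L M P Q : List C} {B : C} (h : L = P ++ (B :: (Q ++ M))) :
    tensorList L ≅ tensorList P ⊗ (B ⊗ (tensorList Q ⊗ tensorList M)) :=
  eqToIso (congrArg tensorList h) ≪≫ tensorListAppend P (B :: (Q ++ M)) ≪≫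
    whiskerLeftIso (tensorList P) (whiskerLeftIso B (tensorListAppend Q M))

/-- Mapping `D` over a concatenated word gives a concatenation only up to equality of lists; the
resulting `eqToHom` has to be moved past a tensor factor. -/
theorem eqToHom_tensorList_cons_comp (X : C) {L L' : List C} {Z : C} (h : L = L')
    (h' : tensorList (X :: L) = tensorList (X :: L')) (g : tensorList L' ⟶ Z) :
    eqToHom h' ≫ (show tensorList (X :: L') ⟶ X ⊗ Z from X ◁ g) =
      X ◁ (eqToHom (congrArg tensorList h) ≫ g) := by
  subst h
  exact (Category.id_comp _).trans (by rw [eqToHom_refl, Category.id_comp])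

theorem tensorListAppend_hom_eqToHom (L : List C) {L' L'' : List C} {Z : C} (h : L' = L'')
    (h' : tensorList (L ++ L') = tensorList (L ++ L'')) (g : tensorList L'' ⟶ Z) :
    (tensorListAppend L L').hom ≫ tensorList L ◁ (eqToHom (congrArg tensorList h) ≫ g) =
      eqToHom h' ≫ (tensorListAppend L L'').hom ≫ tensorList L ◁ g := by
  subst h
  simp

theorem tensorHom_comp_associator_inv {A A' X X' Y Y' Z Z' : C} (x : A ⟶ A') (f : X ⟶ X')
    (g : Y ⟶ Y') (p : Z ⟶ X ⊗ Y) (p' : Z' ⟶ X' ⊗ Y') (q : Z ⟶ Z') (h : q ≫ p' = p ≫ (f ⊗ₘ g)) :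
    (x ⊗ₘ q) ≫ A' ◁ p' ≫ (α_ _ _ _).inv = (A ◁ p ≫ (α_ _ _ _).inv) ≫ ((x ⊗ₘ f) ⊗ₘ g) := by
  rw [← id_tensorHom, tensorHom_comp_tensorHom_assoc, h, Category.assoc,
    ← associator_inv_naturality, ← id_tensorHom, tensorHom_comp_tensorHom_assoc,
    Category.id_comp, Category.comp_id]

theorem tensorHom_comp_whiskerLeft {A A' B B' E E' : C} (f : A ⟶ A') (g : B ⟶ B') (h : E ⟶ E')
    (t : B ⟶ E) (t' : B' ⟶ E') (e : g ≫ t' = t ≫ h) :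
    (f ⊗ₘ g) ≫ A' ◁ t' = A ◁ t ≫ (f ⊗ₘ h) := by
  rw [← id_tensorHom, tensorHom_comp_tensorHom, e, ← id_tensorHom, tensorHom_comp_tensorHom,
    Category.id_comp, Category.comp_id]

theorem comp_comp_whiskerLeft {A A' B B' E E' Z Z' : C} (f : A ⟶ A') (g : B ⟶ B') (h : E ⟶ E')
    (t : B ⟶ E) (t' : B' ⟶ E') (s : Z ⟶ A ⊗ B) (s' : Z' ⟶ A' ⊗ B') (q : Z ⟶ Z')
    (e : q ≫ s' = s ≫ (f ⊗ₘ g)) (e' : g ≫ t' = t ≫ h) :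
    q ≫ s' ≫ A' ◁ t' = (s ≫ A ◁ t) ≫ (f ⊗ₘ h) := by
  rw [reassoc_of% e, tensorHom_comp_whiskerLeft f g h t t' e', Category.assoc]

variable {J : Type*} [Preorder J] (D : J ⥤ C)

/-- The tensor product of the objects `D a` for the letters `a` of a word. -/
abbrev wordObj (s : List J) : C := tensorList (s.map D.obj)

/-- The morphism between tensor products of two words that are comparable letter by letter. -/
def wordMap : (s s' : List J) → List.Forall₂ (· ≤ ·) s s' → (wordObj D s ⟶ wordObj D s')
  | [], [], _ => 𝟙 _
  | [], _ :: _, h => nomatch h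
  | _ :: _, [], h => nomatch h
  | _ :: s, _ :: s', h =>
      D.map (homOfLE (List.forall₂_cons.1 h).1) ⊗ₘ wordMap s s' (List.forall₂_cons.1 h).2

theorem wordMap_cons {a a' : J} {s s' : List J} (ha : a ≤ a') (h : List.Forall₂ (· ≤ ·) s s')
    (h' : List.Forall₂ (· ≤ ·) (a :: s) (a' :: s')) :
    wordMap D (a :: s) (a' :: s') h' = (D.map (homOfLE ha) ⊗ₘ wordMap D s s' h) :=
  rfl

theorem wordMap_refl : (s : List J) → (h : List.Forall₂ (· ≤ ·) s s) → wordMap D s s h = 𝟙 _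
  | [], _ => rfl
  | a :: s, h => by
      have e : (D.map (homOfLE le_rfl) ⊗ₘ 𝟙 (wordObj D s)) = 𝟙 (D.obj a ⊗ wordObj D s) := by simp
      rw [wordMap_cons D le_rfl (List.forall₂_cons.1 h).2, wordMap_refl s]
      exact e

theorem wordMap_trans : (s s' s'' : List J) → (h : List.Forall₂ (· ≤ ·) s s') →
    (h' : List.Forall₂ (· ≤ ·) s' s'') → (h'' : List.Forall₂ (· ≤ ·) s s'') →
    wordMap D s s' h ≫ wordMap D s' s'' h' = wordMap D s s'' h''
  | [], [], [], _, _, _ => Category.comp_id _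
  | [], _ :: _, _, h, _, _ => nomatch h
  | _ :: _, [], _, h, _, _ => nomatch h
  | _, [], _ :: _, _, h, _ => nomatch h
  | _, _ :: _, [], _, h, _ => nomatch h
  | a :: s, a' :: s', a'' :: s'', h, h', h'' => by
      simp only [List.forall₂_cons] at h h' h''
      rw [wordMap_cons D h.1 h.2, wordMap_cons D h'.1 h'.2, wordMap_cons D h''.1 h''.2]
      refine (tensorHom_comp_tensorHom _ _ _ _).trans ?_
      rw [wordMap_trans s s' s'' h.2 h'.2 h''.2, ← D.map_comp, homOfLE_comp]

/-- The splitting of the tensor product of a concatenated word. -/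
def wordAppend (s t : List J) : wordObj D (s ++ t) ≅ wordObj D s ⊗ wordObj D t :=
  eqToIso (congrArg tensorList List.map_append) ≪≫ tensorListAppend (s.map D.obj) (t.map D.obj)

theorem wordAppend_cons (a : J) (s t : List J) :
    (wordAppend D (a :: s) t).hom =
      D.obj a ◁ (wordAppend D s t).hom ≫ (α_ (D.obj a) (wordObj D s) (wordObj D t)).inv := by
  have e : List.map D.obj (s ++ t) = s.map D.obj ++ t.map D.obj := List.map_append
  have e' := eqToHom_tensorList_cons_comp (D.obj a) e
    (congrArg (fun L => tensorList (D.obj a :: L)) e)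
    (tensorListAppend (s.map D.obj) (t.map D.obj)).hom
  exact (Category.assoc _ _ _).symm.trans
    (congrArg (· ≫ (α_ (D.obj a) (wordObj D s) (wordObj D t)).inv) e')

theorem wordMap_append : (s s' t t' : List J) → (h : List.Forall₂ (· ≤ ·) s s') →
    (h' : List.Forall₂ (· ≤ ·) t t') → (h'' : List.Forall₂ (· ≤ ·) (s ++ t) (s' ++ t')) →
    wordMap D (s ++ t) (s' ++ t') h'' ≫ (wordAppend D s' t').hom =
      (wordAppend D s t).hom ≫ (wordMap D s s' h ⊗ₘ wordMap D t t' h')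
  | [], [], t, t', _, h', _ => by
      have e (t : List J) : (wordAppend D [] t).hom = (λ_ (wordObj D t)).inv :=
        Category.id_comp _
      rw [e, e]
      change wordMap D t t' h' ≫ _ = _ ≫ (𝟙 _ ⊗ₘ wordMap D t t' h')
      rw [id_tensorHom, leftUnitor_inv_naturality]
  | [], _ :: _, _, _, h, _, _ => nomatch h
  | _ :: _, [], _, _, h, _, _ => nomatch h
  | a :: s, a' :: s', t, t', h, h', h'' => by
      rw [List.forall₂_cons] at h
      have hst : List.Forall₂ (· ≤ ·) (s ++ t) (s' ++ t') := (List.forall₂_cons.1 h'').2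
      have ih := wordMap_append s s' t t' h.2 h' hst
      rw [wordAppend_cons, wordAppend_cons, wordMap_cons D h.1 h.2]
      exact tensorHom_comp_associator_inv _ _ _ _ _ _ ih

theorem wordMap_splitLeft {s s' sM sM' sP sP' sQ sQ' : List J} {a a' : J}
    (e : s = sM ++ (sP ++ (a :: sQ))) (e' : s' = sM' ++ (sP' ++ (a' :: sQ')))
    (h : s.map D.obj = sM.map D.obj ++ (sP.map D.obj ++ (D.obj a :: sQ.map D.obj)))
    (h' : s'.map D.obj = sM'.map D.obj ++ (sP'.map D.obj ++ (D.obj a' :: sQ'.map D.obj)))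
    (hM : List.Forall₂ (· ≤ ·) sM sM') (hP : List.Forall₂ (· ≤ ·) sP sP') (ha : a ≤ a')
    (hQ : List.Forall₂ (· ≤ ·) sQ sQ') (hs : List.Forall₂ (· ≤ ·) s s') :
    wordMap D s s' hs ≫ (listSplitLeft h').hom = (listSplitLeft h).hom ≫
      (wordMap D _ _ hM ⊗ₘ (wordMap D _ _ hP ⊗ₘ (D.map (homOfLE ha) ⊗ₘ wordMap D _ _ hQ))) := by
  subst e e'
  -- Gathering the list equalities turns the splitting into two instances of `wordAppend`, for which
  -- naturality is `wordMap_append`.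
  have key {sM sP sQ : List J} {a : J} (h : (sM ++ (sP ++ (a :: sQ))).map D.obj =
      sM.map D.obj ++ (sP.map D.obj ++ (D.obj a :: sQ.map D.obj))) :
      (listSplitLeft h).hom = (wordAppend D sM (sP ++ (a :: sQ))).hom ≫
        wordObj D sM ◁ (wordAppend D sP (a :: sQ)).hom := by
    rw [wordAppend, wordAppend, Iso.trans_hom, Iso.trans_hom, Category.assoc, eqToIso.hom,
      eqToIso.hom, tensorListAppend_hom_eqToHom (sM.map D.obj)
      (List.map_append (f := D.obj) (l₁ := sP) (l₂ := a :: sQ)) (by simp), eqToHom_trans_assoc]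
    rfl
  have haQ : List.Forall₂ (· ≤ ·) (a :: sQ) (a' :: sQ') := .cons ha hQ
  have hPaQ : List.Forall₂ (· ≤ ·) (sP ++ (a :: sQ)) (sP' ++ (a' :: sQ')) :=
    List.rel_append hP haQ
  rw [key, key]
  exact comp_comp_whiskerLeft _ _ _ _ _ _ _ _ (wordMap_append D _ _ _ _ hM hPaQ hs)
    (wordMap_append D _ _ _ _ hP haQ hPaQ)

theorem wordMap_splitRight {s s' sM sM' sP sP' sQ sQ' : List J} {b b' : J}
    (e : s = sP ++ (b :: (sQ ++ sM))) (e' : s' = sP' ++ (b' :: (sQ' ++ sM')))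
    (h : s.map D.obj = sP.map D.obj ++ (D.obj b :: (sQ.map D.obj ++ sM.map D.obj)))
    (h' : s'.map D.obj = sP'.map D.obj ++ (D.obj b' :: (sQ'.map D.obj ++ sM'.map D.obj)))
    (hM : List.Forall₂ (· ≤ ·) sM sM') (hP : List.Forall₂ (· ≤ ·) sP sP') (hb : b ≤ b')
    (hQ : List.Forall₂ (· ≤ ·) sQ sQ') (hs : List.Forall₂ (· ≤ ·) s s') :
    wordMap D s s' hs ≫ (listSplitRight h').hom = (listSplitRight h).hom ≫
      (wordMap D _ _ hP ⊗ₘ (D.map (homOfLE hb) ⊗ₘ (wordMap D _ _ hQ ⊗ₘ wordMap D _ _ hM))) := by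
  subst e e'
  have key {sM sP sQ : List J} {b : J} (h : (sP ++ (b :: (sQ ++ sM))).map D.obj =
      sP.map D.obj ++ (D.obj b :: (sQ.map D.obj ++ sM.map D.obj))) :
      (listSplitRight h).hom = (wordAppend D sP (b :: (sQ ++ sM))).hom ≫
        wordObj D sP ◁ (show wordObj D (b :: (sQ ++ sM)) ⟶ _ from
          D.obj b ◁ (wordAppend D sQ sM).hom) := by
    have e : (b :: (sQ ++ sM)).map D.obj = D.obj b :: (sQ.map D.obj ++ sM.map D.obj) := by simp
    have e' : (show wordObj D (b :: (sQ ++ sM)) ⟶ _ from D.obj b ◁ (wordAppend D sQ sM).hom) =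
        eqToHom (congrArg tensorList e) ≫ (show tensorList (D.obj b :: _) ⟶ _ from
          D.obj b ◁ (tensorListAppend (sQ.map D.obj) (sM.map D.obj)).hom) :=
      (eqToHom_tensorList_cons_comp (D.obj b) List.map_append _ _).symm
    rw [e', wordAppend, Iso.trans_hom, Category.assoc, eqToIso.hom,
      tensorListAppend_hom_eqToHom (sP.map D.obj) e (by simp), eqToHom_trans_assoc]
    rfl
  have hQM : List.Forall₂ (· ≤ ·) (sQ ++ sM) (sQ' ++ sM') := List.rel_append hQ hM
  have hbQM : List.Forall₂ (· ≤ ·) (b :: (sQ ++ sM)) (b' :: (sQ' ++ sM')) := .cons hb hQM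
  rw [key, key]
  exact comp_comp_whiskerLeft _ _ _ _ _ _ _ _ (wordMap_append D _ _ _ _ hP hbQM hs)
    (tensorHom_comp_whiskerLeft _ _ _ _ _ (wordMap_append D _ _ _ _ hQ hM hQM))

end Words

/-! ### Segments of words and the linking condition -/

section Segments

variable {J : Type*}

/-- The word of the letters `f a, …, f (a + len - 1)`. -/
def segment (f : ℕ → J) (a len : ℕ) : List J :=
  (List.range' a len).map f

theorem segment_add (f : ℕ → J) (a p q : ℕ) :
    segment f a (p + q) = segment f a p ++ segment f (a + p) q := by
  simp [segment, ← List.range'_append_1]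

theorem segment_succ (f : ℕ → J) (a p : ℕ) :
    segment f a (p + 1) = f a :: segment f (a + 1) p := by
  simp [segment, List.range'_succ]

theorem segment_const (c : J) (a p : ℕ) : segment (fun _ => c) a p = List.replicate p c := by
  simp [segment]

theorem segment_split_left (f : ℕ → J) {n m l r : ℕ} (h : n = m + (l + (r + 1))) :
    segment f 0 n = segment f 0 m ++ (segment f m l ++ (f (m + l) :: segment f (m + l + 1) r)) := by
  rw [h, segment_add, segment_add, segment_succ, Nat.zero_add]

theorem segment_split_right (f : ℕ → J) {n m l r : ℕ} (h : n = m + (l + (r + 1))) :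
    segment f 0 n = segment f 0 l ++ (f l :: (segment f (l + 1) r ++ segment f (l + 1 + r) m)) := by
  rw [h, show m + (l + (r + 1)) = l + ((r + m) + 1) by omega, segment_add, segment_succ,
    segment_add, Nat.zero_add]

theorem map_split_left {β : Type*} (D : J → β) {s sM sP sQ : List J} {a : J}
    (h : s = sM ++ (sP ++ (a :: sQ))) :
    s.map D = sM.map D ++ (sP.map D ++ (D a :: sQ.map D)) := by
  simp [h]

theorem map_split_right {β : Type*} (D : J → β) {s sM sP sQ : List J} {b : J}
    (h : s = sP ++ (b :: (sQ ++ sM))) :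
    s.map D = sP.map D ++ (D b :: (sQ.map D ++ sM.map D)) := by
  simp [h]

theorem forall₂_segment [Preorder J] {f g : ℕ → J} {a b p : ℕ}
    (h : ∀ i < p, f (a + i) ≤ g (b + i)) :
    List.Forall₂ (· ≤ ·) (segment f a p) (segment g b p) := by
  rw [List.forall₂_iff_get]
  refine ⟨by simp [segment], fun i h₁ h₂ => ?_⟩
  have : i < p := by simpa [segment] using h₁
  simpa [segment] using h i this

/-- The letters of `g` are at most the letters of `f` to which they are joined in the
Frobenius-Schur composite. -/
structure Linked [Preorder J] (m l r : ℕ) (g f : ℕ → J) : Prop where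
  outer : ∀ i < m, g (l + 1 + r + i) ≤ f (0 + i)
  left : ∀ i < l, g (0 + i) ≤ f (m + i)
  right : ∀ i < r, g (l + 1 + i) ≤ f (m + l + 1 + i)

theorem Linked.mono [Preorder J] {m l r : ℕ} {g f g' f' : ℕ → J} (h : Linked m l r g f)
    (hg : ∀ i, g' i ≤ g i) (hf : ∀ i, f i ≤ f' i) : Linked m l r g' f' where
  outer i hi := (hg _).trans ((h.outer i hi).trans (hf _))
  left i hi := (hg _).trans ((h.left i hi).trans (hf _))
  right i hi := (hg _).trans ((h.right i hi).trans (hf _))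

end Segments

/-! ### Frobenius-Schur morphisms of words -/

section Words

variable {k : Type w} [Field k] {C : Type u} [Category.{v} C] [Abelian C] [Linear k C]
  [MonoidalCategory C] [MonoidalPreadditive C] [RightRigidCategory C]

theorem FS_eq_sum_of_lists (j : PivotalStructure C) {n l r : ℕ} (h : l + r + 1 ≤ n) {V : C}
    {L M P Q : List C}
    (eL : L = List.replicate n V) (eM : M = List.replicate (n - (l + r + 1)) V)
    (eP : P = List.replicate l V) (eQ : Q = List.replicate r V)
    (hL : L = M ++ (P ++ (V :: Q))) (hR : L = P ++ (V :: (Q ++ M)))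
    (t : TrivialComponent k (tpow V n)) :
    ∃ t' : TrivialComponent k (tensorList L), FS j n l r h V t =
      ∑ i, FSpair j (𝟙 _) (𝟙 _) (𝟙 _) ((listSplitLeft hL).inv ≫ t'.coord i)
        (t'.basis i ≫ (listSplitRight hR).hom) := by
  subst eL eM eP eQ
  exact ⟨t, FS_eq_sum j n l r h V t⟩

variable {J : Type*} [Preorder J] (D : J ⥤ C) (j : PivotalStructure C) {n m l r : ℕ}
  (hn : n = m + (l + (r + 1)))

/-- The two splittings cut the constant word at different positions, so each block occurs in two
presentations; these are equal lists, and the letterwise maps between them are identities. -/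
theorem FS_eq_sum_of_words {l r : ℕ} (h : l + r + 1 ≤ n) {c : J} {s sM sP sQ sM' sP' sQ' : List J}
    (e : s = List.replicate n c) (eM : sM = List.replicate (n - (l + r + 1)) c)
    (eP : sP = List.replicate l c) (eQ : sQ = List.replicate r c)
    (eM' : sM' = List.replicate (n - (l + r + 1)) c)
    (eP' : sP' = List.replicate l c) (eQ' : sQ' = List.replicate r c)
    (hL : s.map D.obj = sM.map D.obj ++ (sP.map D.obj ++ (D.obj c :: sQ.map D.obj)))
    (hR : s.map D.obj = sP'.map D.obj ++ (D.obj c :: (sQ'.map D.obj ++ sM'.map D.obj)))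
    (hM : List.Forall₂ (· ≤ ·) sM' sM) (hP : List.Forall₂ (· ≤ ·) sP' sP)
    (hQ : List.Forall₂ (· ≤ ·) sQ' sQ) (t : TrivialComponent k (tpow (D.obj c) n)) :
    ∃ t' : TrivialComponent k (wordObj D s), FS j n l r h (D.obj c) t =
      ∑ i, FSpair j (wordMap D _ _ hM) (wordMap D _ _ hP) (wordMap D _ _ hQ)
        ((listSplitLeft hL).inv ≫ t'.coord i) (t'.basis i ≫ (listSplitRight hR).hom) := by
  obtain rfl := eM'.trans eM.symm
  obtain rfl := eP'.trans eP.symm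
  obtain rfl := eQ'.trans eQ.symm
  simp only [wordMap_refl]
  exact FS_eq_sum_of_lists j h (by rw [e, List.map_replicate]) (by rw [eM, List.map_replicate])
    (by rw [eP, List.map_replicate]) (by rw [eQ, List.map_replicate]) hL hR t

variable [MonoidalLinear k C]

variable (k) in
/-- The contraction of the Frobenius-Schur composite for tensor products of words. -/
def wordPair (f g : ℕ → J) (h : Linked m l r g f) :
    (wordObj D (segment f 0 n) ⟶ 𝟙_ C) →ₗ[k] (𝟙_ C ⟶ wordObj D (segment g 0 n)) →ₗ[k]
      (D.obj (f (m + l)) ⟶ D.obj (g l)) :=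
  FSpairₗ k j (wordMap D _ _ (forall₂_segment h.outer)) (wordMap D _ _ (forall₂_segment h.left))
    (wordMap D _ _ (forall₂_segment h.right))
    (listSplitLeft (map_split_left D.obj (segment_split_left f hn))).inv
    (listSplitRight (map_split_right D.obj (segment_split_right g hn))).hom

theorem wordPair_comp_left {f f₁ g : ℕ → J} (h : Linked m l r g f) (hf : ∀ i, f i ≤ f₁ i)
    (φ : wordObj D (segment f₁ 0 n) ⟶ 𝟙_ C) (ψ : 𝟙_ C ⟶ wordObj D (segment g 0 n)) :
    wordPair k D j hn f g h (wordMap D _ _ (forall₂_segment fun _ _ => hf _) ≫ φ) ψ =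
      D.map (homOfLE (hf _)) ≫
        wordPair k D j hn f₁ g (h.mono (fun _ => le_rfl) hf) φ ψ := by
  have e := wordMap_splitLeft D (segment_split_left f hn) (segment_split_left f₁ hn)
    (map_split_left D.obj (segment_split_left f hn))
    (map_split_left D.obj (segment_split_left f₁ hn)) (forall₂_segment fun _ _ => hf _)
    (forall₂_segment fun _ _ => hf _) (hf _) (forall₂_segment fun _ _ => hf _)
    (forall₂_segment fun _ _ => hf _)
  rw [← Iso.inv_comp_eq, ← Category.assoc, ← Iso.eq_comp_inv] at e
  simp only [wordPair, FSpairₗ, LinearMap.mk₂_apply]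
  rw [reassoc_of% e, FSpair_comp_left, wordMap_trans, wordMap_trans, wordMap_trans]

theorem wordPair_comp_right {f g g₁ : ℕ → J} (h : Linked m l r g₁ f) (hg : ∀ i, g i ≤ g₁ i)
    (φ : wordObj D (segment f 0 n) ⟶ 𝟙_ C) (ψ : 𝟙_ C ⟶ wordObj D (segment g 0 n)) :
    wordPair k D j hn f g₁ h φ (ψ ≫ wordMap D _ _ (forall₂_segment fun _ _ => hg _)) =
      wordPair k D j hn f g (h.mono hg fun _ => le_rfl) φ ψ ≫ D.map (homOfLE (hg _)) := by
  have e := wordMap_splitRight D (segment_split_right g hn) (segment_split_right g₁ hn)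
    (map_split_right D.obj (segment_split_right g hn))
    (map_split_right D.obj (segment_split_right g₁ hn)) (forall₂_segment fun _ _ => hg _)
    (forall₂_segment fun _ _ => hg _) (hg _) (forall₂_segment fun _ _ => hg _)
    (forall₂_segment fun _ _ => hg _)
  simp only [wordPair, FSpairₗ, LinearMap.mk₂_apply]
  rw [Category.assoc, e, ← Category.assoc, FSpair_comp_right, wordMap_trans, wordMap_trans,
    wordMap_trans]

/-- The Frobenius-Schur morphism of a word, computed with a trivial component of its tensor
product. -/
def wordFS (f : ℕ → J) (h : Linked m l r f f)
    (t : TrivialComponent k (wordObj D (segment f 0 n))) : D.obj (f (m + l)) ⟶ D.obj (f l) :=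
  ∑ i, wordPair k D j hn f f h (t.coord i) (t.basis i)

/-- Dinaturality is applied to the letterwise map from the word of `f` to that of `g` and to the
mixed contraction of functionals on the former with invariants of the latter. `Linked m l r g f` is
what makes that contraction exist. -/
theorem wordFS_naturality (hunit : IsSimpleObject k (𝟙_ C)) {f g : ℕ → J} (hfg : ∀ i, f i ≤ g i)
    (h : Linked m l r g f) (hf : Linked m l r f f) (hg : Linked m l r g g)
    (t : TrivialComponent k (wordObj D (segment f 0 n)))
    (t' : TrivialComponent k (wordObj D (segment g 0 n))) :
    wordFS D j hn f hf t ≫ D.map (homOfLE (hfg l)) =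
      D.map (homOfLE (hfg (m + l))) ≫ wordFS D j hn g hg t' := by
  simp only [wordFS, Preadditive.sum_comp, Preadditive.comp_sum]
  refine ((Finset.sum_congr rfl fun i _ => ?_).trans (TrivialComponent.sum_comp_coord_basis hunit
    t t' (wordMap D _ _ (forall₂_segment fun _ _ => hfg _)) (wordPair k D j hn f g h)).symm).trans
    (Finset.sum_congr rfl fun i _ => ?_)
  · exact (wordPair_comp_right D j hn h hfg _ _).symm
  · exact wordPair_comp_left D j hn h hfg _ _

theorem exists_FS_eq_wordFS {l r : ℕ} (h : l + r + 1 ≤ n)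
    (hn : n = (n - (l + r + 1)) + (l + (r + 1))) (c : J)
    (hc : Linked (n - (l + r + 1)) l r (fun _ => c) (fun _ => c))
    (t : TrivialComponent k (tpow (D.obj c) n)) :
    ∃ t', FS j n l r h (D.obj c) t = wordFS (k := k) D j hn (fun _ => c) hc t' :=
  FS_eq_sum_of_words D j h (segment_const c _ _) (segment_const c _ _) (segment_const c _ _)
    (segment_const c _ _) (segment_const c _ _) (segment_const c _ _) (segment_const c _ _)
    _ _ _ _ _ t

end Words

/-! ### Changing the letters one position at a time -/

section Filling

/-- The letter at position `i` after `t` steps: position `l` and its first `t - 1` translates by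
`-m` modulo `n` are filled. -/
def filling (n m l t i : ℕ) : Fin 2 :=
  open Classical in if ∃ c < t, i + c * m ≡ l [MOD n] then 1 else 0

theorem filling_le_of {n m l t t' i i' : ℕ}
    (h : ∀ c < t, i + c * m ≡ l [MOD n] → ∃ c' < t', i' + c' * m ≡ l [MOD n]) :
    filling n m l t i ≤ filling n m l t' i' := by
  unfold filling
  split_ifs with h₁ h₂
  · exact le_rfl
  · obtain ⟨c, hc, e⟩ := h₁
    exact absurd (h c hc e) h₂
  all_goals exact Fin.zero_le _

theorem filling_mono {n m l t t' : ℕ} (h : t ≤ t') (i : ℕ) :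
    filling n m l t i ≤ filling n m l t' i :=
  filling_le_of fun c hc e => ⟨c, hc.trans_le h, e⟩

theorem filling_zero (n m l : ℕ) : filling n m l 0 = fun _ => 0 := by
  funext i
  simp [filling]

theorem filling_self {n m : ℕ} (l : ℕ) (hn : 0 < n) (h : Nat.Coprime m n) :
    filling n m l n = fun _ => 1 := by
  funext i
  refine if_pos ?_
  have : NeZero n := ⟨hn.ne'⟩
  have hu : IsUnit (m : ZMod n) := (ZMod.isUnit_iff_coprime m n).2 h
  -- The solution `c` of `i + c * m = l` in `ZMod n`, where `m` is a unit.
  refine ⟨(((l : ZMod n) - i) * (m : ZMod n)⁻¹).val, ZMod.val_lt _, ?_⟩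
  rw [← ZMod.natCast_eq_natCast_iff]
  push_cast
  rw [ZMod.natCast_val, ZMod.cast_id, mul_assoc, ZMod.inv_mul_of_unit _ hu]
  ring

/-- Since `i ≠ l`, the number `c` of translations from `i` to `l` is not 0, and `c - 1` translations
lead from `i + m` to `l`. -/
theorem filling_succ_le {n m l t i i' : ℕ} (hi : i < n) (hl : l < n) (hil : i ≠ l)
    (h : i' ≡ i + m [MOD n]) : filling n m l (t + 1) i ≤ filling n m l t i' := by
  refine filling_le_of fun c hc e => ?_
  obtain _ | c := c
  · rw [Nat.zero_mul, Nat.add_zero] at e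
    exact absurd (e.eq_of_lt_of_lt hi hl) hil
  · refine ⟨c, by omega, (h.add_right _).trans ?_⟩
    rwa [show i + m + c * m = i + (c + 1) * m by ring]

theorem linked_filling {n m l r : ℕ} (hn : n = m + (l + (r + 1))) (t : ℕ) :
    Linked m l r (filling n m l (t + 1)) (filling n m l t) where
  outer i hi := by
    refine filling_succ_le (by omega) (by omega) (by omega) ?_
    -- Strands of the block `M` wrap around: adding `m` exceeds `n`.
    rw [show l + 1 + r + i + m = 0 + i + n by omega]
    simp [Nat.ModEq]
  left i hi := filling_succ_le (by omega) (by omega) (by omega) (by rw [Nat.add_comm, Nat.zero_add])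
  right i hi := filling_succ_le (by omega) (by omega) (by omega) (by
    rw [show m + l + 1 + i = l + 1 + i + m by omega])

end Filling

/-! ### Naturality of the Frobenius-Schur endomorphism -/

section Naturality

variable {k : Type w} [Field k] {C : Type u} [Category.{v} C] [Abelian C] [Linear k C]
  [MonoidalCategory C] [MonoidalPreadditive C] [MonoidalLinear k C] [RightRigidCategory C]

theorem linked_filling_self {n m l r : ℕ} (hn : n = m + (l + (r + 1))) (t : ℕ) :
    Linked m l r (filling n m l t) (filling n m l t) :=
  (linked_filling hn t).mono (filling_mono t.le_succ) fun _ => le_rfl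

/-- Composes the single steps. Semisimplicity supplies trivial components of the intermediate mixed
words; their choice is immaterial because `t` is arbitrary at each stage. -/
theorem wordFS_filling (j : PivotalStructure C) (hC : IsSemisimple k C)
    (hunit : IsSimpleObject k (𝟙_ C)) {n m l r : ℕ} (hn : n = m + (l + (r + 1))) (D : Fin 2 ⥤ C)
    (t₀ : TrivialComponent k (wordObj D (segment (filling n m l 0) 0 n))) (c : ℕ) :
    ∀ t : TrivialComponent k (wordObj D (segment (filling n m l c) 0 n)),
    wordFS D j hn _ (linked_filling_self hn 0) t₀ ≫
        D.map (homOfLE (filling_mono c.zero_le l)) =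
      D.map (homOfLE (filling_mono c.zero_le (m + l))) ≫
        wordFS D j hn _ (linked_filling_self hn c) t := by
  induction c with
  | zero =>
    intro t
    exact wordFS_naturality D j hn hunit (fun _ => le_rfl) (linked_filling_self hn 0) _ _ t₀ t
  | succ c ih =>
    intro t
    obtain ⟨t₁⟩ := nonempty_trivialComponent hC (wordObj D (segment (filling n m l c) 0 n))
    have h := wordFS_naturality D j hn hunit (filling_mono c.le_succ) (linked_filling hn c)
      (linked_filling_self hn c) (linked_filling_self hn (c + 1)) t₁ t
    rw [← homOfLE_comp (filling_mono c.zero_le l) (filling_mono c.le_succ l), D.map_comp,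
      reassoc_of% (ih t₁), h, ← D.map_comp_assoc, homOfLE_comp]

theorem FS_naturality (j : PivotalStructure C) (hC : IsSemisimple k C)
    (hunit : IsSimpleObject k (𝟙_ C)) (n l r : ℕ) (h : l + r + 1 ≤ n)
    (hcop : Nat.Coprime n (l + r + 1)) {V W : C} (f : V ⟶ W)
    (t : TrivialComponent k (tpow V n)) (t' : TrivialComponent k (tpow W n)) :
    FS j n l r h V t ≫ f = f ≫ FS j n l r h W t' := by
  let D : Fin 2 ⥤ C := ComposableArrows.mk₁ f
  have hn : n = (n - (l + r + 1)) + (l + (r + 1)) := by omega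
  -- With `k₀ = l + r + 1`: gcd(n - k₀, n) = gcd(n - k₀, k₀) = gcd(n, k₀).
  have hm : Nat.Coprime (n - (l + r + 1)) n := by
    rw [← Nat.coprime_sub_self_right (Nat.sub_le n (l + r + 1)), Nat.sub_sub_self h,
      Nat.coprime_sub_self_left h]
    exact hcop
  have hlink (c : Fin 2) : Linked (n - (l + r + 1)) l r (fun _ => c) (fun _ => c) :=
    ⟨fun _ _ => le_rfl, fun _ _ => le_rfl, fun _ _ => le_rfl⟩
  obtain ⟨s, hs⟩ := exists_FS_eq_wordFS D j h hn 0 (hlink 0) t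
  obtain ⟨s', hs'⟩ := exists_FS_eq_wordFS D j h hn 1 (hlink 1) t'
  -- The types of `s` and `s'` depend on the words, so the end words are made variables before the
  -- fillings are identified with constant words.
  have key (f₀ f₁ : ℕ → Fin 2) (e₀ : filling n (n - (l + r + 1)) l 0 = f₀)
      (e₁ : filling n (n - (l + r + 1)) l n = f₁) (h₀ : Linked _ l r f₀ f₀)
      (h₁ : Linked _ l r f₁ f₁) (h₀₁ : ∀ i, f₀ i ≤ f₁ i)
      (s : TrivialComponent k (wordObj D (segment f₀ 0 n)))
      (s' : TrivialComponent k (wordObj D (segment f₁ 0 n))) :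
      wordFS D j hn f₀ h₀ s ≫ D.map (homOfLE (h₀₁ _)) =
        D.map (homOfLE (h₀₁ _)) ≫ wordFS D j hn f₁ h₁ s' := by
    subst e₀ e₁
    exact wordFS_filling j hC hunit hn D s n s'
  have := key _ _ (filling_zero n _ l) (filling_self l (by omega) hm) (hlink 0) (hlink 1)
    (fun _ => Fin.zero_le _) s s'
  rw [← hs, ← hs'] at this
  exact this

end Naturality

end FrobSchur

end

theorem mainTheorem10 {k : Type w} [Field k] {C : Type u} [Category.{v} C] [Abelian C]
    [Linear k C] [MonoidalCategory C] [MonoidalPreadditive C] [MonoidalLinear k C]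
    [RightRigidCategory C] (j : FrobSchur.PivotalStructure C)
    (hC : FrobSchur.IsSemisimple k C) (hunit : FrobSchur.IsSimpleObject k (𝟙_ C))
    (n l r : ℕ) (h : l + r + 1 ≤ n) (hcop : Nat.Coprime n (l + r + 1)) :
    ∃ η : 𝟭 C ⟶ 𝟭 C, ∀ (V : C) (t : FrobSchur.TrivialComponent k (FrobSchur.tpow V n)),
      η.app V = FrobSchur.FS j n l r h V t := by
  have t (V : C) := (FrobSchur.nonempty_trivialComponent hC (FrobSchur.tpow V n)).some
  refine ⟨⟨fun V => FrobSchur.FS j n l r h V (t V), fun V W f => ?_⟩, fun V t' => ?_⟩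
  · exact (FrobSchur.FS_naturality j hC hunit n l r h hcop f (t V) (t W)).symm
  -- Naturality at the identity compares two trivial components of the same power.
  · simpa using FrobSchur.FS_naturality j hC hunit n l r h hcop (𝟙 V) (t V) t'
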